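/- Let $G$ be an Abelian Polish group, that is, an Abelian topological group whose topology is separable and completely metrizable. Then $G$ is unitarily representable if and only if it is uniformly embeddable in $\ell_2$. Here $G$ is called *unitarily representable* if there are a complex Hilbert space $\mathbb{H}$ and an injective group homomorphism $\rho\colon G\to\mathcal{U}(\mathbb{H})$ that is a homeomorphism onto its image, where $\mathcal{U}(\mathbb{H})$ is the unitary group of $\mathbb{H}$ with the strong operator topology. And $G$ is called *uniformly embeddable in $\ell_2$* if there is an injective map $T\colon G\to\ell_2$ (not necessarily a homomorphism) such that both $T$ and $T^{-1}\colon T(G)\to G$ are uniformly continuous with respect to the group uniformity of $G$ and the norm uniformity of the real Hilbert space $\ell_2=\ell_2(\mathbb{N})$. -/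

import Mathlib

universe u

open Topology

/-- The strong operator topology on the unitary group of a Hilbert space `H`: the topology of
pointwise (norm) convergence on `H`. -/
@[reducible] def unitaryStrongOperatorTopology (H : Type*) [NormedAddCommGroup H]
    [InnerProductSpace ℂ H] [CompleteSpace H] : TopologicalSpace (unitary (H →L[ℂ] H)) :=
  TopologicalSpace.induced (fun (U : unitary (H →L[ℂ] H)) (x : H) => (U : H →L[ℂ] H) x)
    inferInstance

/-- A topological group `G` is unitarily representable if, for some Hilbert space `H`, there is
a group homomorphism from `G` to the unitary group of `H` which is a homeomorphism onto its image,
the unitary group carrying the strong operator topology. -/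
def UnitarilyRepresentable (G : Type u) [Group G] [TopologicalSpace G] : Prop :=
  ∃ (H : Type u) (_ : NormedAddCommGroup H) (_ : InnerProductSpace ℂ H) (_ : CompleteSpace H)
    (ρ : G →* unitary (H →L[ℂ] H)),
    @IsEmbedding G (unitary (H →L[ℂ] H)) _ (unitaryStrongOperatorTopology H) ρ

/-- An abelian topological group `G` is uniformly embeddable in `ℓ₂` if there is an injective map
`T : G → ℓ₂` such that `T` and `T⁻¹ : T(G) → G` are uniformly continuous, where `G` carries its
group uniformity (left and right agree, `G` being abelian) and `ℓ₂` the uniformity of its norm. -/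
def UniformlyEmbeddableInEllTwo (G : Type u) [CommGroup G] [TopologicalSpace G]
    [IsTopologicalGroup G] : Prop :=
  ∃ T : G → lp (fun _ : ℕ => ℝ) 2,
    @IsUniformEmbedding G (lp (fun _ : ℕ => ℝ) 2) (IsTopologicalGroup.rightUniformSpace G) _ T

/-! Representation to embedding: the topology at `1` is generated by the orbit maps `g ↦ ρ g x`, and
first countability leaves countably many vectors. Scaled to be square-summable, they give one map `f
: G → ℓ₂(H)` with `dist (f g) (f h) = N (h * g⁻¹)`, where `N` determines the neighbourhoods of `1`.
Separability moves `f` into `ℓ₂`.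

Embedding to representation: the kernel `exp (-‖T x - T y‖²)` is positive semidefinite (Schoenberg)
but not invariant. As `G` is abelian, Markov–Kakutani averages it to an invariant `K`. Uniform
continuity of `T` and `T⁻¹` amounts to bounds on the kernel along the sets `{(z * h, h)}`. Such
bounds are closed, convex and translation-invariant conditions, so `K` inherits them. The GNS
representation of `K` then has a cyclic vector whose orbit alone recovers the topology of `G`. -/

open scoped Pointwise in
/-- The **Markov–Kakutani fixed point theorem** for commuting continuous linear maps. -/
theorem exists_common_fixedPoint_of_commute {E ι : Type*} [AddCommGroup E] [Module ℝ E]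
    [TopologicalSpace E] [IsTopologicalAddGroup E] [ContinuousSMul ℝ E] [T2Space E]
    (S : ι → E →L[ℝ] E) (hS : ∀ i j, Commute (S i) (S j)) {C : Set E} (hC : IsCompact C)
    (hconv : Convex ℝ C) (hne : C.Nonempty) (hmaps : ∀ i, Set.MapsTo (S i) C C) :
    ∃ x ∈ C, ∀ i, S i x = x := by
  -- Cesàro means of the iterates. A point lying in every image `A p '' C` will be fixed by all `S
  -- i`.
  let A : ι × ℕ → E →L[ℝ] E := fun p =>
    ((p.2 + 1 : ℕ) : ℝ)⁻¹ • ∑ k ∈ Finset.range (p.2 + 1), S p.1 ^ k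
  have hA : ∀ p q, Commute (A p) (A q) := fun p q =>
    ((Commute.sum_left _ _ _ fun k _ => Commute.sum_right _ _ _ fun l _ =>
      (hS p.1 q.1).pow_pow k l).smul_left _).smul_right _
  have hpow : ∀ i k, Set.MapsTo (S i ^ k : E →L[ℝ] E) C C := by
    intro i k
    induction k with
    | zero => intro x hx; simpa using hx
    | succ k ih => intro x hx; rw [pow_succ]; exact ih (hmaps i hx)
  have hAmaps : ∀ p, Set.MapsTo (A p) C C := by
    rintro ⟨i, n⟩ x hx
    have h := hconv.sum_mem (t := Finset.range (n + 1)) (w := fun _ => ((n + 1 : ℕ) : ℝ)⁻¹)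
      (z := fun k => (S i ^ k) x) (fun _ _ => by positivity)
      (by simp; field_simp) (fun k _ => hpow i k hx)
    simpa [A, Finset.smul_sum] using h
  obtain ⟨x, hxC, hx⟩ := hC.inter_iInter_nonempty (fun p => A p '' C)
    (fun p => (hC.image (A p).continuous).isClosed) (by
      classical
      intro s
      induction s using Finset.induction_on with
      | empty => simpa using hne
      | insert p s _ ih =>
        obtain ⟨y, hyC, hy⟩ := ih
        refine ⟨A p y, hAmaps p hyC, ?_⟩
        simp only [Set.mem_iInter] at hy ⊢
        intro q hq
        rcases Finset.mem_insert.1 hq with rfl | hq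
        · exact ⟨y, hyC, rfl⟩
        · obtain ⟨z, hz, rfl⟩ := hy q hq
          exact ⟨A p z, hAmaps p hz, (DFunLike.congr_fun (hA q p) z :)⟩)
  refine ⟨x, hxC, fun i => ?_⟩
  simp only [Set.mem_iInter] at hx
  choose z hzC hz using fun n : ℕ => hx (i, n)
  -- Telescoping: with `x = A (i, n) (z n)`, the defect `S i x - x` is `1 / (n + 1)` times an
  -- element of the bounded set `C - C`.
  have key : ∀ n : ℕ, ((n + 1 : ℕ) : ℝ)⁻¹ • ((S i ^ (n + 1)) (z n) - z n) = S i x - x := by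
    intro n
    have h : (S i - 1) * A (i, n) = ((n + 1 : ℕ) : ℝ)⁻¹ • (S i ^ (n + 1) - 1) := by
      rw [← mul_geom_sum, mul_smul_comm]
    have h' := DFunLike.congr_fun h (z n)
    rw [← hz n]
    simpa using h'.symm
  have hb : Bornology.IsVonNBounded ℝ (C - C) := by
    have : IsCompact (C - C) := by
      simpa only [sub_eq_add_neg] using hC.add hC.neg
    exact this.isVonNBounded ℝ
  have hlim := hb.smul_tendsto_zero (ε := fun n : ℕ => ((n + 1 : ℕ) : ℝ)⁻¹)
    (x := fun n => (S i ^ (n + 1)) (z n) - z n) (l := Filter.atTop)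
    (Filter.Eventually.of_forall fun n => Set.sub_mem_sub (hpow i _ (hzC n)) (hzC n))
    ((tendsto_inv_atTop_nhds_zero_nat (𝕜 := ℝ)).comp (Filter.tendsto_add_atTop_nat 1))
  have hconst : (fun n : ℕ => ((n + 1 : ℕ) : ℝ)⁻¹) • (fun n => (S i ^ (n + 1)) (z n) - z n)
      = fun _ => S i x - x := funext key
  rw [hconst] at hlim
  exact sub_eq_zero.1 (tendsto_nhds_unique tendsto_const_nhds hlim)

/-! ### Positive semidefinite kernels -/

theorem Matrix.PosSemidef.sum_nonneg {ι : Type*} {K : Matrix ι ι ℝ} (hK : K.PosSemidef)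
    (s : Finset ι) (c : ι → ℝ) : 0 ≤ ∑ x ∈ s, ∑ y ∈ s, c x * c y * K x y := by
  classical
  have h := hK.2 (Finsupp.indicator s fun i _ => c i)
  have hsub := Finsupp.support_indicator_subset s (fun i _ => c i)
  rw [Finsupp.sum_of_support_subset _ hsub _ (by simp)] at h
  refine h.trans_eq (Finset.sum_congr rfl fun x hx => ?_)
  rw [Finsupp.sum_of_support_subset _ hsub _ (by simp)]
  refine Finset.sum_congr rfl fun y hy => ?_
  rw [Finsupp.indicator_of_mem hx, Finsupp.indicator_of_mem hy, star_trivial]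
  ring

/-- Entrywise limits of positive semidefinite matrices are positive semidefinite. -/
theorem isClosed_setOf_posSemidef (ι : Type*) :
    IsClosed {K : ι → ι → ℝ | Matrix.PosSemidef (Matrix.of K)} := by
  simp only [Matrix.PosSemidef, Matrix.IsHermitian, ← Matrix.ext_iff, Set.ofPred_and,
    Set.ofPred_forall, Finsupp.sum]
  refine IsClosed.inter ?_ ?_
  · refine isClosed_iInter fun i => isClosed_iInter fun j => ?_
    simp only [Matrix.conjTranspose_apply, Matrix.of_apply, star_trivial]
    exact isClosed_eq (by fun_prop) (by fun_prop)
  · refine isClosed_iInter fun x => ?_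
    simp only [Matrix.of_apply]
    exact isClosed_le (by fun_prop) (by fun_prop)

section Gaussian

variable {ι E : Type*} [NormedAddCommGroup E] [InnerProductSpace ℝ E]

theorem posSemidef_of_inner (v : ι → E) :
    Matrix.PosSemidef (Matrix.of fun x y => inner ℝ (v x) (v y)) := by
  refine ⟨?_, fun c => ?_⟩
  · ext x y
    simp [real_inner_comm]
  · have h : 0 ≤ inner ℝ (c.sum fun i a => a • v i) (c.sum fun i a => a • v i) :=
      real_inner_self_nonneg
    simp only [Finsupp.sum, sum_inner, inner_sum, inner_smul_left, inner_smul_right,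
      Finset.mul_sum] at h
    refine h.trans_eq ?_
    rw [Finset.sum_comm]
    refine Finset.sum_congr rfl fun i _ => Finset.sum_congr rfl fun j _ => ?_
    simp only [conj_trivial, star_trivial, Matrix.of_apply]
    ring

/-- Schur product theorem, iterated. -/
theorem posSemidef_inner_pow (v : ι → E) (k : ℕ) :
    Matrix.PosSemidef (Matrix.of fun x y => inner ℝ (v x) (v y) ^ k) := by
  induction k with
  | zero => simpa using posSemidef_of_inner (fun _ : ι => (1 : ℝ))
  | succ k ih =>
    have h : (Matrix.of fun x y => inner ℝ (v x) (v y) ^ (k + 1)) =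
        (Matrix.of fun x y => inner ℝ (v x) (v y) ^ k).hadamard
          (Matrix.of fun x y => inner ℝ (v x) (v y)) := by
      ext x y
      simp [pow_succ]
    rw [h]
    exact ih.hadamard (posSemidef_of_inner v)

/-- The Taylor polynomials of `exp` have nonnegative coefficients, and positivity survives pointwise
limits. -/
theorem posSemidef_exp_inner (v : ι → E) :
    Matrix.PosSemidef (Matrix.of fun x y => Real.exp (inner ℝ (v x) (v y))) := by
  let P : ℕ → ι → ι → ℝ := fun n x y =>
    ∑ k ∈ Finset.range n, (k.factorial : ℝ)⁻¹ * inner ℝ (v x) (v y) ^ k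
  have hmem := (isClosed_setOf_posSemidef ι).mem_of_tendsto (b := Filter.atTop) (f := P)
    (x := fun x y => Real.exp (inner ℝ (v x) (v y))) ?_ (Filter.Eventually.of_forall fun n => ?_)
  · exact hmem
  · refine tendsto_pi_nhds.2 fun x => tendsto_pi_nhds.2 fun y => ?_
    have h := (NormedSpace.expSeries_div_hasSum_exp (inner ℝ (v x) (v y))).tendsto_sum_nat
    rw [← Real.exp_eq_exp_ℝ] at h
    simpa only [div_eq_inv_mul] using h
  · have h : Matrix.PosSemidef (∑ k ∈ Finset.range n, (k.factorial : ℝ)⁻¹ •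
        Matrix.of fun x y => inner ℝ (v x) (v y) ^ k) :=
      Matrix.posSemidef_sum _ fun k _ => (posSemidef_inner_pow v k).smul (by positivity)
    have hP : Matrix.of (P n) = ∑ k ∈ Finset.range n, (k.factorial : ℝ)⁻¹ •
        Matrix.of fun x y => inner ℝ (v x) (v y) ^ k := by
      ext x y
      simp [P, Matrix.sum_apply]
    exact (hP.symm ▸ h : Matrix.PosSemidef (Matrix.of (P n)))

/-- The Gaussian kernel on a real inner product space is positive semidefinite. -/
theorem posSemidef_gaussian (v : ι → E) :
    Matrix.PosSemidef (Matrix.of fun x y => Real.exp (-dist (v x) (v y) ^ 2)) := by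
  -- Expanding the square splits off a rank-one factor; `√2` absorbs the cross term `2⟪v x, v y⟫`.
  have h : (Matrix.of fun x y => Real.exp (-dist (v x) (v y) ^ 2)) =
      (Matrix.of fun x y => inner ℝ (Real.exp (-‖v x‖ ^ 2)) (Real.exp (-‖v y‖ ^ 2))).hadamard
        (Matrix.of fun x y => Real.exp (inner ℝ (√2 • v x) (√2 • v y))) := by
    ext x y
    simp only [Matrix.of_apply, Matrix.hadamard_apply, dist_eq_norm, norm_sub_sq_real,
      inner_smul_left, inner_smul_right, RCLike.inner_apply, conj_trivial, ← Real.exp_add]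
    congr 1
    have := Real.mul_self_sqrt (show (0 : ℝ) ≤ 2 by norm_num)
    linear_combination (-inner ℝ (v x) (v y)) * this
  rw [h]
  exact (posSemidef_of_inner fun x => Real.exp (-‖v x‖ ^ 2)).hadamard
    (posSemidef_exp_inner fun x => √2 • v x)

end Gaussian

/-- A bounded positive semidefinite kernel on an abelian group can be averaged to a
translation-invariant one, keeping bounds on the diagonals `{(z * h, h) | h}`. -/
theorem exists_invariant_kernel {G : Type*} [CommGroup G] {K₀ : G → G → ℝ}
    (hK₀ : Matrix.PosSemidef (Matrix.of K₀)) (hbd : ∀ x y, K₀ x y ∈ Set.Icc (0 : ℝ) 1) :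
    ∃ K : G → G → ℝ, Matrix.PosSemidef (Matrix.of K) ∧ (∀ g x y, K (g * x) (g * y) = K x y) ∧
      ∀ z a b, (∀ h, K₀ (z * h) h ∈ Set.Icc a b) → ∀ h, K (z * h) h ∈ Set.Icc a b := by
  -- Taking `z = x * y⁻¹` and bounds `0`, `1` places `C` inside a cube, hence compactness by
  -- Tychonoff.
  let C : Set (G → G → ℝ) := {K | Matrix.PosSemidef (Matrix.of K)} ∩
    {K | ∀ z a b, (∀ h, K₀ (z * h) h ∈ Set.Icc a b) → ∀ h, K (z * h) h ∈ Set.Icc a b}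
  let S : G → (G → G → ℝ) →L[ℝ] (G → G → ℝ) := fun g =>
    ContinuousLinearMap.pi fun x => ContinuousLinearMap.pi fun y =>
      (ContinuousLinearMap.proj (g * y) : (G → ℝ) →L[ℝ] ℝ).comp
        (ContinuousLinearMap.proj (g * x) : (G → G → ℝ) →L[ℝ] (G → ℝ))
  have hS : ∀ g K x y, S g K x y = K (g * x) (g * y) := fun g K x y => rfl
  have hcl : IsClosed C := by
    refine (isClosed_setOf_posSemidef G).inter ?_
    simp only [Set.ofPred_forall]
    refine isClosed_iInter fun z => isClosed_iInter fun a => isClosed_iInter fun b =>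
      isClosed_iInter fun _ => isClosed_iInter fun h => ?_
    exact isClosed_Icc.preimage (by fun_prop)
  have hcpt : IsCompact C := by
    refine (isCompact_univ_pi fun _ : G => isCompact_univ_pi fun _ : G =>
      isCompact_Icc (a := (0 : ℝ)) (b := 1)).of_isClosed_subset hcl fun K hK x _ y _ => ?_
    simpa using hK.2 (x * y⁻¹) 0 1 (fun h => hbd _ _) y
  have hconv : Convex ℝ C := by
    intro K hK L hL s t hs ht hst
    refine ⟨?_, fun z a b h₀ h => ?_⟩
    · have := (hK.1.smul hs).add (hL.1.smul ht)
      exact this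
    · exact convex_Icc a b (hK.2 z a b h₀ h) (hL.2 z a b h₀ h) hs ht hst
  obtain ⟨K, hKC, hK⟩ := exists_common_fixedPoint_of_commute S
    (fun g h => by
      ext K x y
      change K (h * (g * x)) (h * (g * y)) = K (g * (h * x)) (g * (h * y))
      rw [mul_left_comm, mul_left_comm h g y])
    hcpt hconv ⟨K₀, hK₀, fun _ _ _ h => h⟩ (by
      rintro g K ⟨hK, hK'⟩
      refine ⟨hK.submatrix (fun x => g * x), fun z a b h₀ h => ?_⟩
      rw [hS, mul_left_comm]
      exact hK' z a b h₀ (g * h))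
  exact ⟨K, hKC.1, fun g x y => congrFun₂ (hK g) x y, hKC.2⟩

/-- The **GNS construction** for a left-invariant real positive semidefinite kernel on a group. -/
theorem exists_unitary_representation_of_kernel {G : Type u} [Group G] {K : G → G → ℝ}
    (hK : Matrix.PosSemidef (Matrix.of K)) (hinv : ∀ g x y, K (g * x) (g * y) = K x y) :
    ∃ (H : Type u) (_ : NormedAddCommGroup H) (_ : InnerProductSpace ℂ H) (_ : CompleteSpace H)
      (ρ : G →* unitary (H →L[ℂ] H)) (v : G → H),
      (∀ x y, inner ℂ (v x) (v y) = (K x y : ℂ)) ∧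
      (∀ g x, (ρ g : H →L[ℂ] H) (v x) = v (g * x)) ∧
      Dense (Submodule.span ℂ (Set.range v) : Set H) := by
  let E := G →₀ ℂ
  have hsymm : ∀ x y, K x y = K y x := fun x y => by simpa using (hK.1.apply x y).symm
  -- The form may be degenerate; the completion later identifies vectors at distance zero.
  let core : PreInnerProductSpace.Core ℂ E :=
    { inner := fun f g => f.sum fun x a => g.sum fun y b => starRingEnd ℂ a * b * (K x y : ℂ)
      conj_inner_symm := fun f g => by
        rw [Finsupp.sum_comm]
        simp only [map_finsuppSum]
        refine Finsupp.sum_congr fun x _ => Finsupp.sum_congr fun y _ => ?_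
        rw [hsymm x y]
        simp [mul_comm]
      re_inner_nonneg := fun f => by
        -- As `K` is real, the real part of `⟪f, f⟫` is the sum of the forms of `re f` and `im f`.
        have h₁ := hK.sum_nonneg f.support fun x => (f x).re
        have h₂ := hK.sum_nonneg f.support fun x => (f x).im
        refine (add_nonneg h₁ h₂).trans_eq ?_
        simp only [Finsupp.sum, map_sum, ← Finset.sum_add_distrib, Matrix.of_apply]
        refine Finset.sum_congr rfl fun x _ => Finset.sum_congr rfl fun y _ => ?_
        simp
        ring
      add_left := fun f g h => by
        rw [Finsupp.sum_add_index'] <;> simp [← Finsupp.sum_add, add_mul]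
      smul_left := fun f g r => by
        rw [Finsupp.sum_smul_index] <;> simp [Finsupp.mul_sum, ← mul_assoc] }
  let : SeminormedAddCommGroup E := InnerProductSpace.Core.toSeminormedAddCommGroup (𝕜 := ℂ)
  let : InnerProductSpace ℂ E := .ofCore core
  have hinner : ∀ f g : E, inner ℂ f g =
      f.sum fun x a => g.sum fun y b => starRingEnd ℂ a * b * (K x y : ℂ) := fun _ _ => rfl
  let L : G → E →ₗ[ℂ] E := fun g => Finsupp.lmapDomain ℂ ℂ fun x => g * x
  have hLinner : ∀ g f, inner ℂ (L g f) (L g f) = inner ℂ f f := by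
    intro g f
    have hL : L g f = Finsupp.mapDomain (fun x => g * x) f := rfl
    rw [hinner, hinner, hL]
    rw [Finsupp.sum_mapDomain_index (by simp) (by simp [add_mul, ← Finsupp.sum_add])]
    refine Finsupp.sum_congr fun x _ => ?_
    rw [Finsupp.sum_mapDomain_index (by simp) (by simp [add_mul, mul_add])]
    simp only [hinv]
  have hLnorm : ∀ g f, ‖L g f‖ = ‖f‖ := fun g f => by
    rw [norm_eq_sqrt_re_inner (𝕜 := ℂ), hLinner, ← norm_eq_sqrt_re_inner]
  let V : G → E →L[ℂ] E := fun g => (⟨L g, hLnorm g⟩ : E →ₗᵢ[ℂ] E).toContinuousLinearMap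
  have hV : ∀ g x a, V g (Finsupp.single x a) = Finsupp.single (g * x) a := fun g x a =>
    Finsupp.mapDomain_single
  let H := UniformSpace.Completion E
  let U : G →* (H →L[ℂ] H) :=
    { toFun := fun g => (V g).completion
      map_one' := by
        ext f
        refine UniformSpace.Completion.induction_on f
          (isClosed_eq (by fun_prop) (by fun_prop)) fun f => ?_
        rw [ContinuousLinearMap.completion_apply_coe]
        have : V 1 f = f := by
          change Finsupp.mapDomain _ f = f
          simp only [one_mul]
          exact Finsupp.mapDomain_id
        rw [this]; rfl
      map_mul' := fun g h => by
        ext f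
        refine UniformSpace.Completion.induction_on f
          (isClosed_eq (by fun_prop) (by fun_prop)) fun f => ?_
        change _ = (V g).completion ((V h).completion f)
        simp only [ContinuousLinearMap.completion_apply_coe]
        congr 1
        change Finsupp.mapDomain _ f = Finsupp.mapDomain _ (Finsupp.mapDomain _ f)
        rw [← Finsupp.mapDomain_comp]
        simp only [Function.comp_def, mul_assoc] }
  have hUcoe : ∀ g (f : E), U g f = (V g f : E) := fun g f =>
    ContinuousLinearMap.completion_apply_coe _ _
  have hUnorm : ∀ g f, ‖U g f‖ = ‖f‖ := fun g f => by
    refine UniformSpace.Completion.induction_on f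
      (isClosed_eq (by fun_prop) (by fun_prop)) fun f => ?_
    rw [hUcoe, UniformSpace.Completion.norm_coe, UniformSpace.Completion.norm_coe]
    exact hLnorm g f
  have hUstar : ∀ g, star (U g) * U g = 1 := fun g =>
    (ContinuousLinearMap.norm_map_iff_adjoint_comp_self (U g)).1 (hUnorm g)
  have hUinv : ∀ g, star (U g) = U g⁻¹ := fun g =>
    left_inv_eq_right_inv (hUstar g) (by rw [← map_mul, mul_inv_cancel, map_one])
  refine ⟨H, inferInstance, inferInstance, inferInstance,
    U.codRestrict (unitary (H →L[ℂ] H)) fun g => Unitary.mem_iff.2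
      ⟨hUstar g, by rw [hUinv, ← map_mul, mul_inv_cancel, map_one]⟩,
    fun x => ((Finsupp.single x 1 : E) : H), fun x y => ?_, fun g x => ?_, ?_⟩
  · rw [UniformSpace.Completion.inner_coe, hinner]
    simp
  · change U g _ = _
    rw [hUcoe, hV]
  · refine UniformSpace.Completion.denseRange_coe.mono ?_
    rintro _ ⟨f, rfl⟩
    have : ((f : E) : H) = UniformSpace.Completion.toComplL (𝕜 := ℂ) f := rfl
    rw [this, ← Finsupp.sum_single f, Finsupp.sum, map_sum]
    refine Submodule.sum_mem _ fun x _ => ?_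
    have : (Finsupp.single x (f x) : E) = f x • Finsupp.single x 1 := by simp
    rw [this, map_smul]
    exact Submodule.smul_mem _ _ (Submodule.subset_span ⟨x, rfl⟩)

/-! ### Maps into `ℓ₂` and the group uniformity -/

theorem Orthonormal.countable {ι E : Type*} [NormedAddCommGroup E] [InnerProductSpace ℝ E]
    [TopologicalSpace.SeparableSpace E] {v : ι → E} (hv : Orthonormal ℝ v) : Countable ι := by
  rw [← Set.countable_univ_iff]
  refine Set.PairwiseDisjoint.countable_of_isOpen (s := fun i => Metric.ball (v i) (1 / 2))
    (fun i _ j _ hij => ?_) (fun _ _ => Metric.isOpen_ball)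
    fun i _ => ⟨v i, Metric.mem_ball_self (by norm_num)⟩
  refine Metric.ball_disjoint_ball ?_
  have h : ‖v i - v j‖ ^ 2 = 2 := by
    rw [norm_sub_sq_real, hv.1, hv.1, hv.2 hij]; norm_num
  rw [dist_eq_norm]
  nlinarith [norm_nonneg (v i - v j)]

/-- Up to isometry, a continuous map from a separable space to a real Hilbert space takes its
values in `ℓ₂`. -/
theorem exists_ellTwo_dist_eq {X E : Type*} [TopologicalSpace X]
    [TopologicalSpace.SeparableSpace X] [NormedAddCommGroup E] [InnerProductSpace ℝ E]
    [CompleteSpace E] {f : X → E} (hf : Continuous f) :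
    ∃ T : X → lp (fun _ : ℕ => ℝ) 2, ∀ x y, dist (T x) (T y) = dist (f x) (f y) := by
  let S : Submodule ℝ E := (Submodule.span ℝ (Set.range f)).topologicalClosure
  have hmem : ∀ x, f x ∈ S := fun x =>
    Submodule.le_topologicalClosure _ (Submodule.subset_span ⟨x, rfl⟩)
  have : TopologicalSpace.SeparableSpace S :=
    ((TopologicalSpace.isSeparable_range hf).span (R := ℝ)).closure.separableSpace
  have : CompleteSpace S := (Submodule.isClosed_topologicalClosure _).completeSpace_coe
  obtain ⟨w, b, -⟩ := exists_hilbertBasis ℝ S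
  have := b.orthonormal.countable
  obtain ⟨e, he⟩ := exists_injective_nat w
  have hon : Orthonormal ℝ fun i : w => (lp.single 2 (e i) (1 : ℝ) : lp (fun _ : ℕ => ℝ) 2) := by
    refine ⟨fun i => by simp [lp.norm_single], fun i j hij => ?_⟩
    change inner ℝ (lp.single 2 (e i) (1 : ℝ) : lp (fun _ : ℕ => ℝ) 2) (lp.single 2 (e j) 1) = 0
    rw [lp.inner_single_left]
    simp [lp.single_apply, he.ne hij]
  let J : S →ₗᵢ[ℝ] lp (fun _ : ℕ => ℝ) 2 :=
    hon.orthogonalFamily.linearIsometry.comp b.repr.toLinearIsometry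
  exact ⟨fun x => J ⟨f x, hmem x⟩, fun x y => by rw [J.dist_map, Subtype.dist_eq]⟩

section RightUniformity

variable {G Y : Type*} [Group G] [TopologicalSpace G] [IsTopologicalGroup G] [PseudoMetricSpace Y]

theorem isUniformInducing_rightUniformSpace_iff {T : G → Y} :
    @IsUniformInducing G Y (IsTopologicalGroup.rightUniformSpace G) _ T ↔
      Filter.comap (fun p : G × G => dist (T p.1) (T p.2)) (𝓝 0) =
        Filter.comap (fun p : G × G => p.2 * p.1⁻¹) (𝓝 1) := by
  let := IsTopologicalGroup.rightUniformSpace G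
  rw [isUniformInducing_iff, Metric.uniformity_eq_comap_nhds_zero, Filter.comap_comap]
  exact Iff.rfl

/-- For an invariant distance, uniform behaviour reduces to neighbourhoods of `1`; injectivity comes
from the `T0` axiom. -/
theorem isUniformEmbedding_rightUniformSpace [T0Space G] {T : G → Y} {N : G → ℝ}
    (hT : ∀ x y, dist (T x) (T y) = N (y * x⁻¹)) (hN : Filter.comap N (𝓝 0) = 𝓝 1) :
    @IsUniformEmbedding G Y (IsTopologicalGroup.rightUniformSpace G) _ T := by
  let := IsTopologicalGroup.rightUniformSpace G
  have h : IsUniformInducing T := by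
    rw [isUniformInducing_rightUniformSpace_iff, ← hN, Filter.comap_comap]
    simp only [hT, Function.comp_def]
  exact h.isUniformEmbedding

end RightUniformity

/-- In an infimum of filters that is countably generated, countably many terms
suffice. -/
theorem exists_seq_iInf_eq {α ι : Type*} [Nonempty ι] {l : Filter α} [l.IsCountablyGenerated]
    {f : ι → Filter α} (h : l = ⨅ i, f i) : ∃ x : ℕ → ι, l = ⨅ n, f (x n) := by
  obtain ⟨V, hV⟩ := l.exists_antitone_basis
  have hF : ∀ k, ∃ F : Finset ι, V k ∈ ⨅ i ∈ F, f i := fun k =>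
    (Filter.mem_iInf_finite _).1 (h ▸ hV.1.mem_of_mem trivial)
  choose F hF using hF
  obtain ⟨i₀⟩ := ‹Nonempty ι›
  -- Inserting `i₀` keeps the index set nonempty, so that a sequence can enumerate it.
  obtain ⟨x, hx⟩ := ((Set.countable_iUnion fun k => (F k).countable_toSet).insert
    i₀).exists_eq_range (Set.insert_nonempty _ _)
  refine ⟨x, le_antisymm (le_iInf fun n => h ▸ iInf_le f (x n)) ?_⟩
  rw [hV.1.ge_iff]
  intro k _
  have hle : ⨅ n, f (x n) ≤ ⨅ i ∈ F k, f i := by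
    refine le_iInf₂ fun i hi => ?_
    obtain ⟨n, rfl⟩ : i ∈ Set.range x :=
      hx ▸ Set.mem_insert_of_mem _ (Set.mem_iUnion.2 ⟨k, hi⟩)
    exact iInf_le _ n
  exact hle (hF k)

/-! ### From representations to embeddings -/

theorem UnitarilyRepresentable.uniformlyEmbeddableInEllTwo {G : Type u} [CommGroup G]
    [TopologicalSpace G] [IsTopologicalGroup G] [TopologicalSpace.SeparableSpace G]
    [FirstCountableTopology G] [T0Space G] (h : UnitarilyRepresentable G) :
    UniformlyEmbeddableInEllTwo G := by
  obtain ⟨H, _, _, _, ρ, hρ⟩ := h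
  have hmul : ∀ g h x, (ρ (g * h) : H →L[ℂ] H) x = (ρ g : H →L[ℂ] H) ((ρ h : H →L[ℂ] H) x) :=
    fun g h x => by rw [map_mul]; rfl
  have hone : ∀ x, (ρ 1 : H →L[ℂ] H) x = x := fun x => by rw [map_one]; rfl
  have hind : IsInducing fun (g : G) (x : H) => (ρ g : H →L[ℂ] H) x := by
    let := unitaryStrongOperatorTopology H
    exact (IsInducing.mk rfl : IsInducing
      fun (U : unitary (H →L[ℂ] H)) (x : H) => (U : H →L[ℂ] H) x).comp hρ.isInducing
  have hcont : ∀ x, Continuous fun g => (ρ g : H →L[ℂ] H) x := fun x =>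
    (continuous_apply x).comp hind.continuous
  have hnhds : 𝓝 (1 : G) = ⨅ x : H, Filter.comap (fun g => (ρ g : H →L[ℂ] H) x) (𝓝 x) := by
    rw [hind.nhds_eq_comap, nhds_pi, Filter.pi, Filter.comap_iInf]
    simp only [Filter.comap_comap, Function.comp_def, hone]
  obtain ⟨x, hx⟩ := exists_seq_iInf_eq hnhds
  let w : ℕ → ℝ := fun n => (1 / 2) ^ n / (1 + ‖x n‖)
  have hw : ∀ n, 0 < w n := fun n => by positivity
  have hwx : ∀ n, w n * ‖x n‖ ≤ (1 / 2) ^ n := fun n => by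
    rw [div_mul_eq_mul_div, div_le_iff₀ (by positivity)]
    gcongr
    linarith
  let y : ℕ → H := fun n => (w n : ℂ) • x n
  have hy : ∀ n, ‖y n‖ ≤ (1 / 2) ^ n := fun n => by
    rw [norm_smul, Complex.norm_real, Real.norm_of_nonneg (hw n).le]
    exact hwx n
  have hsum : Summable fun n : ℕ => ((1 / 2 : ℝ) ^ n) ^ 2 := by
    simp_rw [← pow_mul, mul_comm _ 2, pow_mul]
    exact summable_geometric_of_lt_one (by norm_num) (by norm_num)
  have hmem : ∀ g, Memℓp (fun n => (ρ g : H →L[ℂ] H) (y n)) 2 := fun g => by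
    refine memℓp_gen ?_
    simp only [ENNReal.toReal_ofNat, Real.rpow_ofNat, Unitary.norm_map]
    exact hsum.of_nonneg_of_le (fun n => by positivity) fun n => by gcongr; exact hy n
  let f : G → lp (fun _ : ℕ => H) 2 := fun g => ⟨fun n => (ρ g : H →L[ℂ] H) (y n), hmem g⟩
  have hf : ∀ g h n, (f g - f h) n = (ρ g : H →L[ℂ] H) (y n) - (ρ h : H →L[ℂ] H) (y n) :=
    fun g h n => rfl
  have hsq : ∀ g h, ‖f g - f h‖ ^ 2 =
      ∑' n, ‖(ρ g : H →L[ℂ] H) (y n) - (ρ h : H →L[ℂ] H) (y n)‖ ^ 2 := fun g h => by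
    simpa [hf] using lp.norm_rpow_eq_tsum (by norm_num) (f g - f h)
  let N : G → ℝ := fun g => ‖f g - f 1‖
  have hdist : ∀ g h, dist (f g) (f h) = N (h * g⁻¹) := by
    intro g h
    rw [dist_comm, dist_eq_norm, ← sq_eq_sq₀ (norm_nonneg _) (norm_nonneg _), hsq, hsq]
    refine tsum_congr fun n => ?_
    -- Commutativity lets the isometry `ρ g` be pulled out on the left, leaving the right quotient
    -- `h * g⁻¹`.
    have e₁ : (ρ h : H →L[ℂ] H) (y n) = (ρ g : H →L[ℂ] H) ((ρ (h * g⁻¹) : H →L[ℂ] H) (y n)) := by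
      rw [← hmul, mul_comm h, mul_inv_cancel_left]
    rw [hone, e₁, ← map_sub, Unitary.norm_map]
  have hNcont : Continuous N := by
    have h₂ : Continuous fun g => N g ^ 2 := by
      simp only [N, hsq]
      refine continuous_tsum (u := fun n => 4 * ((1 / 2 : ℝ) ^ n) ^ 2)
        (fun n => (((hcont _).sub continuous_const).norm.pow 2)) (hsum.mul_left 4) fun n g => ?_
      have hle : ‖(ρ g : H →L[ℂ] H) (y n) - (ρ 1 : H →L[ℂ] H) (y n)‖ ≤ 2 * (1 / 2) ^ n := by
        refine (norm_sub_le _ _).trans ?_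
        rw [Unitary.norm_map, Unitary.norm_map]
        linarith [hy n]
      rw [Real.norm_of_nonneg (by positivity)]
      calc _ ≤ (2 * (1 / 2 : ℝ) ^ n) ^ 2 := by gcongr
        _ = _ := by ring
    refine h₂.sqrt.congr fun g => Real.sqrt_sq (norm_nonneg _)
  have hN1 : N 1 = 0 := by simp [N]
  have hN : Filter.comap N (𝓝 0) = 𝓝 1 := by
    refine le_antisymm ?_ (by rw [← Filter.tendsto_iff_comap, ← hN1]; exact hNcont.tendsto 1)
    rw [hx]
    refine le_iInf fun n => ?_
    rw [← Filter.tendsto_iff_comap, tendsto_iff_norm_sub_tendsto_zero]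
    -- The `n`-th coordinate of `f g - f 1` is `w n • (ρ g (x n) - x n)`, so `N g` controls it.
    have ht : Filter.Tendsto (fun g => (w n)⁻¹ * N g) (Filter.comap N (𝓝 0)) (𝓝 0) := by
      simpa using (Filter.tendsto_comap (f := N) (x := 𝓝 0)).const_mul (w n)⁻¹
    refine squeeze_zero (fun _ => norm_nonneg _) (fun g => ?_) ht
    have hle := lp.norm_apply_le_norm (by norm_num) (f g - f 1) n
    rw [hf, hone, map_smul, ← smul_sub, norm_smul, Complex.norm_real,
      Real.norm_of_nonneg (hw n).le] at hle
    rwa [le_inv_mul_iff₀ (hw n)]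
  have hfcont : Continuous f := by
    refine continuous_iff_continuousAt.2 fun g => tendsto_iff_dist_tendsto_zero.2 ?_
    simp only [hdist]
    have : Continuous fun h => N (g * h⁻¹) := hNcont.comp (by fun_prop)
    simpa [hN1] using this.tendsto g
  let : InnerProductSpace ℝ (lp (fun _ : ℕ => H) 2) := InnerProductSpace.rclikeToReal ℂ _
  obtain ⟨T, hT⟩ := exists_ellTwo_dist_eq hfcont
  exact ⟨T, isUniformEmbedding_rightUniformSpace (fun g h => (hT g h).trans (hdist g h)) hN⟩

/-! ### From embeddings to representations -/

theorem UniformlyEmbeddableInEllTwo.unitarilyRepresentable {G : Type u} [CommGroup G]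
    [TopologicalSpace G] [IsTopologicalGroup G] [T0Space G] (h : UniformlyEmbeddableInEllTwo G) :
    UnitarilyRepresentable G := by
  obtain ⟨T, hT⟩ := h
  have hcomap := isUniformInducing_rightUniformSpace_iff.1
    (@IsUniformEmbedding.isUniformInducing _ _ (IsTopologicalGroup.rightUniformSpace G) _ _ hT)
  have hbd : ∀ x y, Real.exp (-dist (T x) (T y) ^ 2) ∈ Set.Icc (0 : ℝ) 1 := fun x y =>
    ⟨by positivity, Real.exp_le_one_iff.2 (by nlinarith [sq_nonneg (dist (T x) (T y))])⟩
  obtain ⟨K, hK, hinv, hIcc⟩ := exists_invariant_kernel (posSemidef_gaussian T) hbd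
  have hK1 : ∀ x y, K x y ≤ 1 := fun x y => by
    simpa using (hIcc (x * y⁻¹) 0 1 (fun h => hbd _ _) y).2
  have hdiag : ∀ x, K x x = 1 := fun x => by
    simpa using hIcc 1 1 1 (fun h => by simp) x
  have hcont : ∀ g : G, Filter.Tendsto (fun x => K x g) (𝓝 g) (𝓝 1) := by
    intro g
    rw [Metric.tendsto_nhds]
    intro ε hε
    have hexp : Filter.Tendsto (fun d : ℝ => Real.exp (-d ^ 2)) (𝓝 0) (𝓝 1) := by
      have : Continuous fun d : ℝ => Real.exp (-d ^ 2) := by fun_prop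
      simpa using this.tendsto 0
    have h₁ : ∀ᶠ p in Filter.comap (fun p : G × G => p.2 * p.1⁻¹) (𝓝 1),
        1 - ε / 2 < Real.exp (-dist (T p.1) (T p.2) ^ 2) := by
      rw [← hcomap]
      exact (hexp.comp Filter.tendsto_comap).eventually (lt_mem_nhds (by linarith))
    obtain ⟨U, hU, hUsub⟩ := h₁
    have h₂ : ∀ᶠ x in 𝓝 g, g * x⁻¹ ∈ U := by
      have : Continuous fun x : G => g * x⁻¹ := by fun_prop
      exact this.tendsto g (by simpa using hU)
    filter_upwards [h₂] with x hx
    have hlow := (hIcc (x * g⁻¹) (1 - ε / 2) 1 (fun h => ⟨?_, (hbd _ _).2⟩) g).1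
    · rw [inv_mul_cancel_right] at hlow
      rw [Real.dist_eq, abs_sub_lt_iff]
      constructor <;> linarith [hK1 x g]
    · exact (hUsub (a := (x * g⁻¹ * h, h)) (by simpa using hx)).le
  have hsep : ∀ g : G, Filter.comap (fun x => K x g) (𝓝 1) ≤ 𝓝 g := by
    intro g U hU
    have hU1 : (fun z : G => z⁻¹ * g) ⁻¹' U ∈ 𝓝 (1 : G) := by
      have : Continuous fun z : G => z⁻¹ * g := by fun_prop
      exact this.tendsto 1 (by simpa using hU)
    have h₁ : {p : G × G | (p.2 * p.1⁻¹)⁻¹ * g ∈ U} ∈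
        Filter.comap (fun p : G × G => dist (T p.1) (T p.2)) (𝓝 0) := by
      rw [hcomap]
      exact Filter.preimage_mem_comap hU1
    obtain ⟨ε, hε, hεsub⟩ := (Metric.nhds_basis_ball.comap _).mem_iff.1 h₁
    have hlt : Real.exp (-ε ^ 2) < 1 := Real.exp_lt_one_iff.2 (by nlinarith [pow_pos hε 2])
    refine Filter.mem_of_superset (Filter.preimage_mem_comap (lt_mem_nhds hlt)) fun x hx => ?_
    by_contra hxU
    -- The quotient of `x * g⁻¹ * h` and `h` does not depend on `h`, so `x ∉ U` keeps their images
    -- `ε` apart for every `h`.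
    have hup := (hIcc (x * g⁻¹) 0 (Real.exp (-ε ^ 2)) (fun h => ⟨by positivity, ?_⟩) g).2
    · rw [inv_mul_cancel_right] at hup
      exact absurd hx (not_lt.2 hup)
    · rw [Real.exp_le_exp, neg_le_neg_iff]
      gcongr
      by_contra hlt
      refine hxU ?_
      have : (h * (x * g⁻¹ * h)⁻¹)⁻¹ * g ∈ U := hεsub (a := (x * g⁻¹ * h, h)) (by
        simpa [abs_of_nonneg dist_nonneg] using hlt)
      simpa using this
  obtain ⟨H, _, _, _, ρ, v, hv, hρv, hdense⟩ := exists_unitary_representation_of_kernel hK hinv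
  have hnorm : ∀ x y, ‖v x - v y‖ ^ 2 = 2 - 2 * K x y := by
    intro x y
    rw [norm_sub_sq (𝕜 := ℂ), ← inner_self_eq_norm_sq (𝕜 := ℂ), ← inner_self_eq_norm_sq (𝕜 := ℂ)]
    simp only [hv, hdiag, RCLike.re_to_complex, Complex.ofReal_re]
    ring
  have hvcont : Continuous v := by
    refine continuous_iff_continuousAt.2 fun g => tendsto_iff_norm_sub_tendsto_zero.2 ?_
    have h₂ : Filter.Tendsto (fun x => ‖v x - v g‖ ^ 2) (𝓝 g) (𝓝 0) := by
      simp only [hnorm]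
      simpa using ((hcont g).const_mul 2).const_sub 2
    simpa using h₂.sqrt
  have hρcont : ∀ x : H, Continuous fun g => (ρ g : H →L[ℂ] H) x := by
    have hspan : ∀ x ∈ Submodule.span ℂ (Set.range v),
        Continuous fun g => (ρ g : H →L[ℂ] H) x := by
      intro x hx
      induction hx using Submodule.span_induction with
      | mem x hx =>
        obtain ⟨y, rfl⟩ := hx
        simp only [hρv]
        exact hvcont.comp (by fun_prop)
      | zero => simpa using continuous_const
      | add x y _ _ hx hy =>
        simp only [map_add]
        exact hx.add hy
      | smul a x _ hx =>
        simp only [map_smul]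
        exact hx.const_smul a
    intro x
    -- The operators are isometric, so approximating `x` from the span is uniform in `g`.
    refine continuous_of_uniform_approx_of_continuous fun s hs => ?_
    obtain ⟨ε, hε, hεs⟩ := Metric.mem_uniformity_dist.1 hs
    obtain ⟨y, hy, hxy⟩ := hdense.exists_dist_lt x hε
    refine ⟨_, hspan y hy, fun g => hεs ?_⟩
    rwa [dist_eq_norm, ← map_sub, Unitary.norm_map, ← dist_eq_norm]
  have hind : IsInducing fun (g : G) (x : H) => (ρ g : H →L[ℂ] H) x := by
    refine isInducing_iff_nhds.2 fun g => le_antisymm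
      (Filter.tendsto_iff_comap.1 ((continuous_pi hρcont).tendsto g)) ?_
    refine le_trans ?_ (hsep g)
    rw [← Filter.tendsto_iff_comap]
    -- Evaluation at the cyclic vector `v 1` suffices: `ρ h (v 1) = v h`, and `K h g = 1 - ‖v h - v
    -- g‖² / 2`.
    have h₁ : Filter.Tendsto (fun h => v h)
        (Filter.comap (fun (g : G) (x : H) => (ρ g : H →L[ℂ] H) x)
          (𝓝 fun x => (ρ g : H →L[ℂ] H) x)) (𝓝 (v g)) := by
      have := ((continuous_apply (v 1)).tendsto fun x => (ρ g : H →L[ℂ] H) x).comp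
        (Filter.tendsto_comap (f := fun (g : G) (x : H) => (ρ g : H →L[ℂ] H) x))
      simpa [Function.comp_def, hρv] using this
    have h₂ := ((tendsto_iff_norm_sub_tendsto_zero.1 h₁).pow 2).const_mul (1 / 2) |>.const_sub 1
    simp only [hnorm] at h₂
    convert h₂ using 2 <;> ring
  refine ⟨H, inferInstance, inferInstance, inferInstance, ρ, ?_⟩
  let := unitaryStrongOperatorTopology H
  have hcoe : IsInducing fun (U : unitary (H →L[ℂ] H)) (x : H) => (U : H →L[ℂ] H) x := ⟨rfl⟩
  exact (hcoe.of_comp_iff.1 hind).isEmbedding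

theorem corollary2p4 (G : Type u) [CommGroup G] [TopologicalSpace G] [IsTopologicalGroup G]
    [PolishSpace G] :
    UnitarilyRepresentable G ↔ UniformlyEmbeddableInEllTwo G :=
  ⟨fun h => h.uniformlyEmbeddableInEllTwo, fun h => h.unitarilyRepresentable⟩
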